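/- Let $\widetilde{SL_2\mathbb R}$ be the universal covering group of $SL_2\mathbb R$ (equivalently, of $PSL_2\mathbb R=\mathrm{Isom}^+\mathbb H^2$), and let $SL_2\mathbb R$ act on the upper half-plane $\mathbb H^2$ by fractional linear transformations. Every $A\in SL_2\mathbb R$ can be written uniquely as $A=R(A)S(A)$ with $S(A)$ symmetric positive definite and $$R(A)=\begin{pmatrix}\cos\theta&\sin\theta\\-\sin\theta&\cos\theta\end{pmatrix}\in SO_2\mathbb R,\qquad \theta\in\mathbb R/2\pi\mathbb Z .$$ Milnor's angle function $\Theta:\widetilde{SL_2\mathbb R}\to\mathbb R$ is the lift of $A\mapsto\theta$ with $\Theta(1)=0$: if $\tilde\alpha$ is the homotopy class (with fixed endpoints) of a path $\gamma:[0,1]\to SL_2\mathbb R$ with $\gamma(0)=1$, then $\Theta(\tilde\alpha)=\theta(1)$, where $\theta:[0,1]\to\mathbb R$ is the continuous function such that $\theta(0)=0$ and $\theta(t)$ is an angle of $R(\gamma(t))$ for every $t$. For $p,q,r\in\mathbb H^2$ let $\Delta[p,q,r]$ be the signed hyperbolic area of the (possibly degenerate) geodesic triangle with ordered vertices $p,q,r$,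 positive if they are in anticlockwise order. Then for all $\tilde\alpha,\tilde\beta\in\widetilde{SL_2\mathbb R}$, with images $\alpha,\beta\in SL_2\mathbb R$, $$\Theta(\tilde\beta\tilde\alpha)=\Theta(\tilde\beta)+\Theta(\tilde\alpha)-\tfrac12\,\Delta[i,\beta i,\beta\alpha i],$$ and hence $$\bigl|\Theta(\tilde\beta\tilde\alpha)-\Theta(\tilde\beta)-\Theta(\tilde\alpha)\bigr|<\frac{\pi}{2}.$$ -/

import Mathlib

noncomputable section

namespace Milnor

open UpperHalfPlane MeasureTheory
open scoped unitInterval MatrixGroups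

/-! ### The universal covering group, as homotopy classes of paths starting at the identity -/

section UniversalCover

variable (G : Type*) [Group G] [TopologicalSpace G] [IsTopologicalGroup G]

/-- Continuous paths `[0,1] → G` starting at the identity, a group under pointwise
multiplication. -/
def basedPaths : Subgroup C(I, G) where
  carrier := {γ | γ 0 = 1}
  mul_mem' := by
    intro a b ha hb
    simp only [Set.mem_ofPred_eq] at ha hb ⊢
    simp [ha, hb]
  one_mem' := by simp
  inv_mem' := by
    intro a ha
    simp only [Set.mem_ofPred_eq] at ha ⊢
    simp [ha]

/-- Homotopy of paths with fixed endpoints. It is compatible with pointwise multiplication. -/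
def pathCon : Con (basedPaths G) where
  r γ δ := ContinuousMap.HomotopicRel (γ : C(I, G)) (δ : C(I, G)) {0, 1}
  iseqv :=
    ⟨fun γ => ContinuousMap.HomotopicRel.refl _, fun h => h.symm, fun h k => h.trans k⟩
  mul' := by
    rintro w x y z ⟨F⟩ ⟨H⟩
    exact ⟨{ toFun := fun p => F p * H p
             continuous_toFun := F.continuous.mul H.continuous
             map_zero_left := fun t => by simp
             map_one_left := fun t => by simp
             prop' := fun s t ht => by
               have h1 := F.eq_fst s ht
               have h2 := H.eq_fst s ht
               simp only [ContinuousMap.coe_mk]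
               rw [h1, h2]
               rfl }⟩

/-- The universal covering group of a (path connected, locally contractible) topological group
`G`: homotopy classes, with fixed endpoints, of paths starting at the identity, multiplied
pointwise. -/
abbrev UniversalCover : Type _ := (pathCon G).Quotient

/-- The covering homomorphism, sending the class of a path to its endpoint. -/
def UniversalCover.proj : UniversalCover G →* G :=
  (pathCon G).lift
    { toFun := fun γ => (γ : C(I, G)) 1
      map_one' := rfl
      map_mul' := fun _ _ => rfl }
    (by
      rintro γ δ ⟨F⟩
      have h1 := F.eq_fst 0 (x := (1 : I)) (by simp)
      have h2 := F.eq_snd 0 (x := (1 : I)) (by simp)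
      exact h1.symm.trans h2)

end UniversalCover

/-- The universal covering group of `SL(2, ℝ)`, which is also that of `PSL(2, ℝ)`. -/
abbrev SL2Tilde : Type := UniversalCover SL(2, ℝ)

/-- The element of `SL(2, ℝ)` underlying an element of the universal covering group. -/
abbrev SL2Tilde.proj : SL2Tilde →* SL(2, ℝ) := UniversalCover.proj SL(2, ℝ)

/-! ### The rotation angle -/

/-- The exponential map of `SO(2)`. -/
def rotation (θ : ℝ) : Matrix (Fin 2) (Fin 2) ℝ :=
  !![Real.cos θ, Real.sin θ; -Real.sin θ, Real.cos θ]

/-- `θ` is a rotation angle of `A`: in the polar decomposition `A = R S`, with `R` a rotation and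
`S` symmetric positive definite, one has `R = rotation θ`. -/
def IsRotationAngle (A : SL(2, ℝ)) (θ : ℝ) : Prop :=
  ∃ S : Matrix (Fin 2) (Fin 2) ℝ, S.PosDef ∧ (A : Matrix (Fin 2) (Fin 2) ℝ) = rotation θ * S

/-- `θ` is the continuous choice of rotation angles along the path `γ` starting from `0`, that is,
the lift to `ℝ`, starting from `0`, of the path of rotation parts of `γ` in `SO(2)`. -/
structure IsAngleLift (γ : C(I, SL(2, ℝ))) (θ : C(I, ℝ)) : Prop where
  zero : θ 0 = 0
  angle : ∀ t, IsRotationAngle (γ t) (θ t)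

/-- A complex number whose direction gives the rotation part of `A`. -/
def polarNumber (A : SL(2, ℝ)) : ℂ := ⟨A 0 0 + A 1 1, A 0 1 - A 1 0⟩

theorem polarNumber_ne_zero (A : SL(2, ℝ)) : polarNumber A ≠ 0 := by
  intro h
  have h1 : A 0 0 + A 1 1 = 0 := congrArg Complex.re h
  have h2 : A 0 1 - A 1 0 = 0 := congrArg Complex.im h
  have h3 := A.det_coe
  rw [Matrix.det_fin_two, eq_neg_of_add_eq_zero_right h1, ← sub_eq_zero.mp h2] at h3
  nlinarith [sq_nonneg (A 0 0), sq_nonneg (A 0 1)]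

/-- The rotation part of `A`, as a point of the unit circle. -/
def polarCircle : C(SL(2, ℝ), Circle) where
  toFun A := ⟨polarNumber A / ‖polarNumber A‖, by
    simp [Submonoid.unitSphere, norm_ne_zero_iff.mpr (polarNumber_ne_zero A)]⟩
  continuous_toFun := by
    have hentry : ∀ i j, Continuous fun A : SL(2, ℝ) => A i j := fun i j =>
      (Continuous.matrix_elem continuous_subtype_val i j)
    have hc : Continuous polarNumber := by
      have : polarNumber = fun A : SL(2, ℝ) =>
          ((A 0 0 + A 1 1 : ℝ) : ℂ) + ((A 0 1 - A 1 0 : ℝ) : ℂ) * Complex.I := by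
        funext A
        apply Complex.ext <;> simp [polarNumber]
      rw [this]
      have h00 := hentry 0 0
      have h01 := hentry 0 1
      have h10 := hentry 1 0
      have h11 := hentry 1 1
      fun_prop
    refine Continuous.subtype_mk (hc.div (by fun_prop) fun A => ?_) _
    simpa using polarNumber_ne_zero A

theorem polarCircle_one : polarCircle 1 = Circle.exp 0 := by
  apply Circle.ext
  have h : polarNumber 1 = 2 := by
    apply Complex.ext <;> norm_num [polarNumber]
  change polarNumber 1 / (‖polarNumber 1‖ : ℂ) = _
  simp [h]

theorem isRotationAngle_iff_exists (A : SL(2, ℝ)) (θ : ℝ) :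
    IsRotationAngle A θ ↔
      ∃ r : ℝ, 0 < r ∧ A 0 0 + A 1 1 = r * Real.cos θ ∧ A 0 1 - A 1 0 = r * Real.sin θ := by
  have hsc := Real.sin_sq_add_cos_sq θ
  constructor
  · rintro ⟨S, hS, hA⟩
    have hsym : S 1 0 = S 0 1 := by simpa using hS.1.apply 0 1
    have htr := hS.trace_pos
    rw [Matrix.trace_fin_two] at htr
    refine ⟨S 0 0 + S 1 1, htr, ?_, ?_⟩
    · rw [hA]
      simp [rotation, Matrix.mul_apply, Fin.sum_univ_two, hsym]
      ring
    · rw [hA]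
      simp [rotation, Matrix.mul_apply, Fin.sum_univ_two, hsym]
      ring
  · rintro ⟨r, hr, h1, h2⟩
    have hdet := A.det_coe
    rw [Matrix.det_fin_two] at hdet
    set a := A 0 0
    set b := A 0 1
    set c := A 1 0
    set d := A 1 1
    set C := Real.cos θ
    set s := Real.sin θ
    have hq : C * b - s * d = s * a + C * c := by
      have : C * (b - c) = s * (a + d) := by rw [h1, h2]; ring
      linarith
    have htr : (C * a - s * c) + (s * b + C * d) = r := by
      have : (C * a - s * c) + (s * b + C * d) = C * (a + d) + s * (b - c) := by ring
      rw [this, h1, h2]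
      linear_combination r * hsc
    have hd : (C * a - s * c) * (s * b + C * d) - (C * b - s * d) ^ 2 = 1 := by
      have : (C * a - s * c) * (s * b + C * d) - (C * b - s * d) * (s * a + C * c) = 1 := by
        linear_combination (s ^ 2 + C ^ 2) * hdet + hsc
      rw [← hq] at this
      linarith
    have hp : 0 < C * a - s * c := by
      by_contra hcon
      push Not at hcon
      nlinarith [sq_nonneg (C * b - s * d)]
    refine ⟨!![C * a - s * c, C * b - s * d; C * b - s * d, s * b + C * d], ?_, ?_⟩
    · refine Matrix.PosDef.of_dotProduct_mulVec_pos ?_ ?_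
      · ext i j
        fin_cases i <;> fin_cases j <;> simp
      · intro x hx
        have hx' : x 0 ≠ 0 ∨ x 1 ≠ 0 := by
          by_contra hcon
          push Not at hcon
          apply hx
          funext i
          fin_cases i
          · exact hcon.1
          · exact hcon.2
        simp only [dotProduct, Matrix.mulVec, Fin.sum_univ_two, Pi.star_apply, star_trivial,
          Matrix.cons_val_zero, Matrix.cons_val_one, Matrix.of_apply, Matrix.cons_val',
          Matrix.cons_val_fin_one]
        generalize C * a - s * c = p at *
        generalize s * b + C * d = t at *
        generalize C * b - s * d = q at *
        have key : p * (x 0 * (p * x 0 + q * x 1) + x 1 * (q * x 0 + t * x 1)) =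
            (p * x 0 + q * x 1) ^ 2 + x 1 ^ 2 := by
          linear_combination (x 1) ^ 2 * hd
        have hpos : 0 < (p * x 0 + q * x 1) ^ 2 + x 1 ^ 2 := by
          by_cases h : x 1 = 0
          · have h0 : x 0 ≠ 0 := by tauto
            rw [h]
            have : 0 < (p * x 0) ^ 2 := by positivity
            simpa using this
          · positivity
        rw [← key] at hpos
        exact (mul_pos_iff_of_pos_left hp).mp hpos
    · ext i j
      fin_cases i <;> fin_cases j <;>
        simp [rotation, Matrix.mul_apply, Fin.sum_univ_two]
      · change a = C * (C * a - s * c) + s * (C * b - s * d)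
        rw [hq]
        linear_combination -a * hsc
      · change b = C * (C * b - s * d) + s * (s * b + C * d)
        linear_combination -b * hsc
      · change c = -(s * (C * a - s * c)) + C * (C * b - s * d)
        rw [hq]
        linear_combination -c * hsc
      · change d = -(s * (C * b - s * d)) + C * (s * b + C * d)
        linear_combination -d * hsc

theorem isRotationAngle_iff (A : SL(2, ℝ)) (θ : ℝ) :
    IsRotationAngle A θ ↔ Circle.exp θ = polarCircle A := by
  have hz := polarNumber_ne_zero A
  have hn : 0 < ‖polarNumber A‖ := norm_pos_iff.mpr hz
  have hn' : (‖polarNumber A‖ : ℂ) ≠ 0 := by exact_mod_cast hn.ne'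
  have hexp : ∀ r : ℝ, (A 0 0 + A 1 1 = r * Real.cos θ ∧ A 0 1 - A 1 0 = r * Real.sin θ) ↔
      polarNumber A = r * Complex.exp (θ * Complex.I) := by
    intro r
    rw [Complex.exp_mul_I, ← Complex.ofReal_cos, ← Complex.ofReal_sin, Complex.ext_iff]
    simp [polarNumber, -Complex.ofReal_cos, -Complex.ofReal_sin]
  rw [isRotationAngle_iff_exists]
  have hcirc : Circle.exp θ = polarCircle A ↔
      Complex.exp (θ * Complex.I) = polarNumber A / ‖polarNumber A‖ := by
    rw [Circle.ext_iff, Circle.coe_exp]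
    rfl
  rw [hcirc, eq_div_iff hn']
  constructor
  · rintro ⟨r, hr, h⟩
    rw [hexp] at h
    have : ‖polarNumber A‖ = r := by
      rw [h, norm_mul, Complex.norm_exp_ofReal_mul_I, Complex.norm_real, Real.norm_of_nonneg hr.le,
        mul_one]
    rw [this, h]
    ring
  · intro h
    refine ⟨‖polarNumber A‖, hn, (hexp _).mpr ?_⟩
    rw [mul_comm]
    exact h.symm

theorem isAngleLift_iff {γ : C(I, SL(2, ℝ))} (hγ : γ 0 = 1) (θ : C(I, ℝ)) :
    IsAngleLift γ θ ↔ θ = Circle.isCoveringMap_exp.liftPath (polarCircle.comp γ) 0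
      (by simp only [ContinuousMap.comp_apply, hγ, polarCircle_one]) := by
  rw [IsCoveringMap.eq_liftPath_iff']
  constructor
  · rintro ⟨h0, h1⟩
    exact ⟨funext fun t => (isRotationAngle_iff _ _).mp (h1 t), h0⟩
  · rintro ⟨h1, h0⟩
    exact ⟨h0, fun t => (isRotationAngle_iff _ _).mpr (congrFun h1 t)⟩

theorem existsUnique_angleLift {γ : C(I, SL(2, ℝ))} (hγ : γ 0 = 1) :
    ∃! θ : C(I, ℝ), IsAngleLift γ θ :=
  ⟨_, (isAngleLift_iff hγ _).mpr rfl, fun _ h => (isAngleLift_iff hγ _).mp h⟩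

/-- The continuous rotation angle along a path starting at the identity. -/
def angleLift (γ : basedPaths SL(2, ℝ)) : C(I, ℝ) :=
  (existsUnique_angleLift γ.2).choose

theorem isAngleLift_angleLift (γ : basedPaths SL(2, ℝ)) : IsAngleLift γ (angleLift γ) :=
  (existsUnique_angleLift γ.2).choose_spec.1

theorem angleLift_one_eq {γ δ : basedPaths SL(2, ℝ)} (h : pathCon SL(2, ℝ) γ δ) :
    angleLift γ 1 = angleLift δ 1 := by
  rw [(isAngleLift_iff γ.2 _).mp (isAngleLift_angleLift γ),
    (isAngleLift_iff δ.2 _).mp (isAngleLift_angleLift δ)]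
  exact Circle.isCoveringMap_exp.liftPath_apply_one_eq_of_homotopicRel
    (ContinuousMap.HomotopicRel.comp_continuousMap h polarCircle) _ _ _

/-- Milnor's angle function `Θ`: the lift of the rotation angle to a real-valued function on the
universal covering group, vanishing at the identity. Its value at the class of a path is the final
value of the continuous rotation angle along that path. -/
def milnorTheta : SL2Tilde → ℝ :=
  Quotient.lift (fun γ : basedPaths SL(2, ℝ) => angleLift γ 1) fun _ _ h => angleLift_one_eq h

theorem milnorTheta_mk (γ : basedPaths SL(2, ℝ)) {θ : C(I, ℝ)}
    (h : IsAngleLift (γ : C(I, SL(2, ℝ))) θ) :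
    milnorTheta (γ : (pathCon SL(2, ℝ)).Quotient) = θ 1 := by
  change angleLift γ 1 = θ 1
  rw [(existsUnique_angleLift γ.2).unique (isAngleLift_angleLift γ) h]

/-! ### Signed areas of hyperbolic triangles -/

/-- The geodesic segment from `p` to `q` in the hyperbolic plane. -/
def geodesicSegment (p q : ℍ) : Set ℍ := {z | dist p z + dist z q = dist p q}

/-- The filled, possibly degenerate geodesic triangle with vertices `p`, `q`, `r`: the union of the
geodesic segments from `p` to the points of the side from `q` to `r`. -/
def geodesicTriangle (p q r : ℍ) : Set ℍ :=
  {z | ∃ w ∈ geodesicSegment q r, z ∈ geodesicSegment p w}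

/-- The conformal (orientation-preserving) map from the upper half-plane to the unit disc that
sends `p` to `0`, and hence geodesics through `p` to diameters. -/
def discCoord (p z : ℍ) : ℂ := ((z : ℂ) - p) / ((z : ℂ) - (starRingEnd ℂ) (p : ℂ))

/-- The orientation of a hyperbolic triangle with ordered vertices `p`, `q`, `r`: `1` if they are in
anticlockwise order, `-1` if they are in clockwise order and `0` if they lie on a geodesic. It is
the sign of the sine of the angle at `p` from the side `p q` to the side `p r`. -/
def triangleOrientation (p q r : ℍ) : ℝ :=
  Real.sign (((starRingEnd ℂ) (discCoord p q) * discCoord p r).im)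

/-- The signed hyperbolic area of the triangle with ordered vertices `p`, `q`, `r`, positive if
they are in anticlockwise order; the volume on `ℍ` is the hyperbolic area `dx dy / y ^ 2`. -/
def signedArea (p q r : ℍ) : ℝ :=
  triangleOrientation p q r * (volume : Measure ℍ).real (geodesicTriangle p q r)

end Milnor

end

noncomputable section

namespace Milnor

open UpperHalfPlane MeasureTheory
open scoped unitInterval MatrixGroups

/-! ### The hyperboloid and the Klein disc -/

/-! Let `polarNumber A` be `P(A) = (a + d) + i(b - c)`; its argument is the rotation angle of `A`.
The number `N(B, A) = P(BA) · conj P(B) · conj P(A)` (`angleDefectNumber`) therefore has argument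
`θ(BA) - θ(B) - θ(A)` modulo `2π`. Written in the hyperboloid coordinates `x₀, x₁, x₂` of `x = B i`
and `y = BA i`, its real part is `2(1 + x₀ + y₀ + cosh d(x, y))` and its imaginary part is `-2(x₁y₂
- x₂y₁)` (`angleDefectNumber_eq`). The real part is positive, so the principal argument of `N` is
continuous, lies strictly between `-π/2` and `π/2`, and vanishes at the identity. Adding it to the
angle lifts of two paths gives the angle lift of their product, and uniqueness of lifts makes the
congruence modulo `2π` an equality (`milnorTheta_mul`). The bound follows at once.

It remains to see that `arg N = -Δ/2`, that is, `tan(Δ/2) = -Im N / Re N` (`signedArea_I`). In the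
Klein disc a geodesic triangle with vertex `i` is a Euclidean triangle with vertex `0`, and the area
density is `(1 - |k|²)^(-3/2)`. The integral along rays from `0` is elementary, and the remaining
integral along the opposite side has an explicit arctangent as primitive (`hasDerivAt_arctan_area`).
-/

/-- The time-like coordinate of a point of the hyperbolic plane on the hyperboloid. -/
def hyp0 (z : ℍ) : ℝ := (z.re ^ 2 + z.im ^ 2 + 1) / (2 * z.im)

/-- The first space-like coordinate of a point of the hyperbolic plane on the hyperboloid. -/
def hyp1 (z : ℍ) : ℝ := (z.re ^ 2 + z.im ^ 2 - 1) / (2 * z.im)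

/-- The second space-like coordinate of a point of the hyperbolic plane on the hyperboloid. -/
def hyp2 (z : ℍ) : ℝ := -z.re / z.im

theorem hyp_sq (z : ℍ) : hyp0 z ^ 2 - hyp1 z ^ 2 - hyp2 z ^ 2 = 1 := by
  have := z.im_pos.ne'
  simp only [hyp0, hyp1, hyp2]
  field_simp
  ring

theorem hyp0_pos (z : ℍ) : 0 < hyp0 z := by
  have := z.im_pos
  unfold hyp0
  positivity

theorem hyp0_sub_hyp1 (z : ℍ) : hyp0 z - hyp1 z = 1 / z.im := by
  have := z.im_pos.ne'
  simp only [hyp0, hyp1]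
  field_simp
  ring

theorem eq_of_hyp_eq {z w : ℍ} (h0 : hyp0 z = hyp0 w) (h1 : hyp1 z = hyp1 w)
    (h2 : hyp2 z = hyp2 w) : z = w := by
  have hz := hyp0_sub_hyp1 z
  rw [h0, h1, hyp0_sub_hyp1 w] at hz
  have him : z.im = w.im := by
    rw [one_div, one_div, inv_inj] at hz
    exact hz.symm
  have hw := w.im_pos.ne'
  have hre : z.re = w.re := by
    simp only [hyp2, him] at h2
    field_simp at h2
    linarith
  exact UpperHalfPlane.ext_re_im hre him

theorem cosh_dist_eq_hyp (z w : ℍ) :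
    Real.cosh (dist z w) = hyp0 z * hyp0 w - hyp1 z * hyp1 w - hyp2 z * hyp2 w := by
  have hz := z.im_pos.ne'
  have hw := w.im_pos.ne'
  rw [UpperHalfPlane.cosh_dist']
  simp only [hyp0, hyp1, hyp2]
  field_simp
  ring

/-- A vector that is null and orthogonal to a time-like unit vector vanishes. -/
theorem eq_zero_of_null_of_orthogonal {a b c x y z : ℝ} (ha : a ^ 2 - b ^ 2 - c ^ 2 = 1)
    (hx : x ^ 2 - y ^ 2 - z ^ 2 = 0) (hax : a * x - b * y - c * z = 0) :
    x = 0 ∧ y = 0 ∧ z = 0 := by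
  have hx0 : x = 0 := by
    have h1 : (a * x) ^ 2 ≤ (b ^ 2 + c ^ 2) * (y ^ 2 + z ^ 2) := by
      have : a * x = b * y + c * z := by linarith
      rw [this]
      nlinarith [sq_nonneg (b * z - c * y)]
    have h2 : x ^ 2 = y ^ 2 + z ^ 2 := by linarith
    have h3 : a ^ 2 = 1 + (b ^ 2 + c ^ 2) := by linarith
    rw [mul_pow, h3, ← h2] at h1
    nlinarith [sq_nonneg x]
  subst hx0
  refine ⟨rfl, ?_, ?_⟩ <;> nlinarith [sq_nonneg y, sq_nonneg z]

/-- Geodesics are the sections of the hyperboloid by planes through the origin, and a segment is the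
part inside the cone spanned by its endpoints. -/
theorem mem_geodesicSegment_iff_hyp (p q z : ℍ) :
    z ∈ geodesicSegment p q ↔ ∃ l m : ℝ, 0 ≤ l ∧ 0 ≤ m ∧ hyp0 z = l * hyp0 p + m * hyp0 q ∧
      hyp1 z = l * hyp1 p + m * hyp1 q ∧ hyp2 z = l * hyp2 p + m * hyp2 q := by
  have hp := hyp_sq p
  have hq := hyp_sq q
  have hz := hyp_sq z
  have ha := cosh_dist_eq_hyp p z
  have hb := cosh_dist_eq_hyp z q
  have hc := cosh_dist_eq_hyp p q
  have ea := Real.cosh_sq (dist p z)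
  have eb := Real.cosh_sq (dist z q)
  have ec := Real.cosh_sq (dist p q)
  change dist p z + dist z q = dist p q ↔ _
  constructor
  · intro h
    by_cases hpq : p = q
    · subst hpq
      rw [dist_self] at h
      have hpz : p = z := dist_le_zero.mp (by linarith [dist_nonneg (x := z) (y := p)])
      subst hpz
      exact ⟨1, 0, by simp, le_rfl, by simp, by simp, by simp⟩
    · have hpos : 0 < Real.sinh (dist p q) := Real.sinh_pos_iff.mpr (dist_pos.mpr hpq)
      have hsa : 0 ≤ Real.sinh (dist p z) := Real.sinh_nonneg_iff.mpr dist_nonneg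
      have hsb : 0 ≤ Real.sinh (dist z q) := Real.sinh_nonneg_iff.mpr dist_nonneg
      have hs := Real.sinh_add (dist p z) (dist z q)
      have hch := Real.cosh_add (dist p z) (dist z q)
      rw [h] at hs hch
      rw [ha, hb, hc] at hch
      rw [ha, hb] at hs
      rw [ha] at ea
      rw [hb] at eb
      rw [hc] at ec
      generalize Real.sinh (dist p z) = sa at *
      generalize Real.sinh (dist z q) = sb at *
      generalize Real.sinh (dist p q) = sc at *
      -- On the segment, `sinh d(p,q) · z = sinh d(z,q) · p + sinh d(p,z) · q`. The addition
      -- formulas for `cosh` and `sinh` show that the difference of the two sides is null and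
      -- orthogonal to `z`.
      obtain ⟨h0, h1, h2⟩ := eq_zero_of_null_of_orthogonal (a := hyp0 z) (b := hyp1 z) (c := hyp2 z)
        (x := sc * hyp0 z - sb * hyp0 p - sa * hyp0 q)
        (y := sc * hyp1 z - sb * hyp1 p - sa * hyp1 q)
        (z := sc * hyp2 z - sb * hyp2 p - sa * hyp2 q) hz
        (by
          set A := hyp0 p * hyp0 z - hyp1 p * hyp1 z - hyp2 p * hyp2 z with hA
          set B := hyp0 z * hyp0 q - hyp1 z * hyp1 q - hyp2 z * hyp2 q with hB
          set C := hyp0 p * hyp0 q - hyp1 p * hyp1 q - hyp2 p * hyp2 q with hC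
          have : sc ^ 2 + sb ^ 2 + sa ^ 2 - 2 * sc * sb * A - 2 * sc * sa * B + 2 * sb * sa * C
              = 0 := by
            rw [hch, hs]
            linear_combination (sb ^ 2 * (-1)) * ea - sa ^ 2 * eb
          rw [hA, hB, hC] at this
          linear_combination this + sc ^ 2 * hz + sb ^ 2 * hp + sa ^ 2 * hq)
        (by linear_combination hs + sc * hz)
      refine ⟨sb / sc, sa / sc, by positivity, by positivity, ?_, ?_, ?_⟩ <;> field_simp <;>
        linarith
  · rintro ⟨l, m, hl, hm, h0, h1, h2⟩
    set C := Real.cosh (dist p q) with hC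
    have hA' : Real.cosh (dist p z) = l + m * C := by
      rw [ha, hc, h0, h1, h2]
      linear_combination l * hp
    have hB' : Real.cosh (dist z q) = l * C + m := by
      rw [hb, hc, h0, h1, h2]
      linear_combination m * hq
    have hn : l ^ 2 + m ^ 2 + 2 * l * m * C = 1 := by
      rw [h0, h1, h2] at hz
      rw [hc]
      linear_combination hz - l ^ 2 * hp - m ^ 2 * hq
    have hsc : 0 ≤ Real.sinh (dist p q) := Real.sinh_nonneg_iff.mpr dist_nonneg
    -- With both hyperbolic sines proportional to `sinh d(p,q)`, the addition formula and `hn` give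
    -- `sinh (d(p,z) + d(z,q)) = sinh d(p,q)`.
    have hsa : Real.sinh (dist p z) = m * Real.sinh (dist p q) := by
      refine (sq_eq_sq₀ (Real.sinh_nonneg_iff.mpr dist_nonneg) (by positivity)).mp ?_
      rw [hA'] at ea
      linear_combination -ea + m ^ 2 * ec + hn
    have hsb : Real.sinh (dist z q) = l * Real.sinh (dist p q) := by
      refine (sq_eq_sq₀ (Real.sinh_nonneg_iff.mpr dist_nonneg) (by positivity)).mp ?_
      rw [hB'] at eb
      linear_combination -eb + l ^ 2 * ec + hn
    have hsinh : Real.sinh (dist p z + dist z q) = Real.sinh (dist p q) := by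
      rw [Real.sinh_add, hsa, hsb, hA', hB']
      linear_combination Real.sinh (dist p q) * hn
    exact Real.sinh_injective hsinh

/-- The Klein model of the hyperbolic plane, in which geodesics are straight lines. -/
def klein (z : ℍ) : ℝ × ℝ := (hyp1 z / hyp0 z, hyp2 z / hyp0 z)

theorem klein_I : klein UpperHalfPlane.I = 0 := by
  simp [klein, hyp1, hyp2]

theorem klein_sq_lt_one (z : ℍ) : (klein z).1 ^ 2 + (klein z).2 ^ 2 < 1 := by
  have h := hyp0_pos z
  simp only [klein, div_pow]
  rw [← add_div, div_lt_one (by positivity)]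
  linarith [hyp_sq z]

theorem sqrt_one_sub_klein_sq (z : ℍ) :
    √(1 - ((klein z).1 ^ 2 + (klein z).2 ^ 2)) = 1 / hyp0 z := by
  have h := hyp0_pos z
  rw [Real.sqrt_eq_iff_mul_self_eq_of_pos (by positivity)]
  simp only [klein]
  field_simp
  linarith [hyp_sq z]

theorem klein_injective : Function.Injective klein := by
  intro z w h
  have hz := hyp0_pos z
  have hw := hyp0_pos w
  have h0 : hyp0 z = hyp0 w := by
    have := sqrt_one_sub_klein_sq z
    rw [h, sqrt_one_sub_klein_sq w, one_div, one_div, inv_inj] at this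
    exact this.symm
  simp only [klein, Prod.mk.injEq, h0] at h
  obtain ⟨h1, h2⟩ := h
  exact eq_of_hyp_eq h0 ((div_left_inj' hw.ne').mp h1) ((div_left_inj' hw.ne').mp h2)

/-- The inverse of the Klein model, as a map to the coordinates of the upper half-plane. -/
def kleinInv (k : ℝ × ℝ) : ℝ × ℝ :=
  (-k.2 / (1 - k.1), √(1 - (k.1 ^ 2 + k.2 ^ 2)) / (1 - k.1))

theorem fst_lt_one_of_sq_lt_one {k : ℝ × ℝ} (hk : k.1 ^ 2 + k.2 ^ 2 < 1) : k.1 < 1 := by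
  nlinarith [sq_nonneg k.2]

theorem kleinInv_snd_pos {k : ℝ × ℝ} (hk : k.1 ^ 2 + k.2 ^ 2 < 1) : 0 < (kleinInv k).2 :=
  div_pos (Real.sqrt_pos.mpr (by linarith)) (by linarith [fst_lt_one_of_sq_lt_one hk])

theorem exists_klein_eq {k : ℝ × ℝ} (hk : k.1 ^ 2 + k.2 ^ 2 < 1) :
    ∃ z : ℍ, klein z = k ∧ (z.re, z.im) = kleinInv k := by
  have h1 : 0 < 1 - k.1 := by linarith [fst_lt_one_of_sq_lt_one hk]
  refine ⟨⟨⟨(kleinInv k).1, (kleinInv k).2⟩, kleinInv_snd_pos hk⟩, ?_, rfl⟩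
  have hs : 0 < √(1 - (k.1 ^ 2 + k.2 ^ 2)) := Real.sqrt_pos.mpr (by linarith)
  have hs2 : √(1 - (k.1 ^ 2 + k.2 ^ 2)) ^ 2 = 1 - (k.1 ^ 2 + k.2 ^ 2) :=
    Real.sq_sqrt (by linarith)
  have key : ∀ z : ℍ, z.re = -k.2 / (1 - k.1) → z.im = √(1 - (k.1 ^ 2 + k.2 ^ 2)) / (1 - k.1) →
      klein z = k := by
    intro z hre him
    generalize √(1 - (k.1 ^ 2 + k.2 ^ 2)) = s at *
    have h0 : hyp0 z = 1 / s := by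
      rw [hyp0, hre, him]
      field_simp
      rw [hs2]
      ring
    have hh1 : hyp1 z = k.1 / s := by
      rw [hyp1, hre, him]
      field_simp
      rw [hs2]
      ring
    have hh2 : hyp2 z = k.2 / s := by
      rw [hyp2, hre, him]
      field_simp
    rw [klein, h0, hh1, hh2]
    ext <;> field_simp
  exact key _ rfl rfl

theorem kleinInv_klein (z : ℍ) : kleinInv (klein z) = (z.re, z.im) := by
  obtain ⟨w, hw, h⟩ := exists_klein_eq (klein_sq_lt_one z)
  rw [← h, klein_injective hw]

/-- Central projection from the hyperboloid turns planes through the origin into lines; rescaling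
the cone coefficients by the time coordinates makes them sum to `1`. -/
theorem mem_geodesicSegment_iff_klein (p q z : ℍ) :
    z ∈ geodesicSegment p q ↔
      ∃ t ∈ Set.Icc (0 : ℝ) 1, klein z = (1 - t) • klein p + t • klein q := by
  have hp := hyp0_pos p
  have hq := hyp0_pos q
  have hz := hyp0_pos z
  rw [mem_geodesicSegment_iff_hyp]
  constructor
  · rintro ⟨l, m, hl, hm, h0, h1, h2⟩
    have ht : 1 - m * hyp0 q / hyp0 z = l * hyp0 p / hyp0 z := by
      field_simp
      linarith
    refine ⟨m * hyp0 q / hyp0 z, ⟨by positivity, ?_⟩, ?_⟩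
    · have : 0 ≤ l * hyp0 p / hyp0 z := by positivity
      linarith
    · rw [ht]
      ext
      · simp only [klein, Prod.fst_add, Prod.smul_fst, smul_eq_mul, h1]
        field_simp
      · simp only [klein, Prod.snd_add, Prod.smul_snd, smul_eq_mul, h2]
        field_simp
  · rintro ⟨t, ⟨ht0, ht1⟩, h⟩
    have h1 := congrArg Prod.fst h
    have h2 := congrArg Prod.snd h
    simp only [klein, Prod.fst_add, Prod.smul_fst, smul_eq_mul, Prod.snd_add, Prod.smul_snd]
      at h1 h2
    have ht1' : 0 ≤ 1 - t := by linarith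
    refine ⟨(1 - t) * hyp0 z / hyp0 p, t * hyp0 z / hyp0 q, by positivity, by positivity,
      ?_, ?_, ?_⟩
    · field_simp
      ring
    · rw [div_eq_iff hz.ne'] at h1
      rw [h1]
      field_simp
    · rw [div_eq_iff hz.ne'] at h2
      rw [h2]
      field_simp

theorem convex_combination_sq_lt_one {p q : ℝ × ℝ} (hp : p.1 ^ 2 + p.2 ^ 2 < 1)
    (hq : q.1 ^ 2 + q.2 ^ 2 < 1) {t : ℝ} (ht : t ∈ Set.Icc (0 : ℝ) 1) :
    ((1 - t) • p + t • q).1 ^ 2 + ((1 - t) • p + t • q).2 ^ 2 < 1 := by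
  obtain ⟨h0, h1⟩ := ht
  simp only [Prod.fst_add, Prod.smul_fst, smul_eq_mul, Prod.snd_add, Prod.smul_snd]
  have key : ((1 - t) * p.1 + t * q.1) ^ 2 + ((1 - t) * p.2 + t * q.2) ^ 2 =
      (1 - t) * (p.1 ^ 2 + p.2 ^ 2) + t * (q.1 ^ 2 + q.2 ^ 2)
        - t * (1 - t) * ((p.1 - q.1) ^ 2 + (p.2 - q.2) ^ 2) := by ring
  rw [key]
  have h3 : 0 ≤ t * (1 - t) * ((p.1 - q.1) ^ 2 + (p.2 - q.2) ^ 2) :=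
    mul_nonneg (mul_nonneg h0 (by linarith)) (by positivity)
  rcases h0.eq_or_lt with h | h
  · subst h
    simpa using hp
  · nlinarith

theorem mem_geodesicTriangle_I_iff (q r z : ℍ) :
    z ∈ geodesicTriangle UpperHalfPlane.I q r ↔ ∃ s ∈ Set.Icc (0 : ℝ) 1, ∃ t ∈ Set.Icc (0 : ℝ) 1,
      klein z = s • ((1 - t) • klein q + t • klein r) := by
  constructor
  · rintro ⟨w, hw, hz⟩
    obtain ⟨t, ht, h1⟩ := (mem_geodesicSegment_iff_klein _ _ _).mp hw
    obtain ⟨s, hs, h2⟩ := (mem_geodesicSegment_iff_klein _ _ _).mp hz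
    refine ⟨s, hs, t, ht, ?_⟩
    rw [h2, h1, klein_I, smul_zero, zero_add]
  · rintro ⟨s, hs, t, ht, h⟩
    obtain ⟨w, hw, -⟩ :=
      exists_klein_eq (convex_combination_sq_lt_one (klein_sq_lt_one q) (klein_sq_lt_one r) ht)
    refine ⟨w, (mem_geodesicSegment_iff_klein _ _ _).mpr ⟨t, ht, hw⟩,
      (mem_geodesicSegment_iff_klein _ _ _).mpr ⟨s, hs, ?_⟩⟩
    rw [h, hw, klein_I, smul_zero, zero_add]

/-! ### The hyperbolic area element in the Klein model -/

/-- The derivative of `kleinInv`. -/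
def kleinInvDeriv (k : ℝ × ℝ) : ℝ × ℝ →L[ℝ] ℝ × ℝ :=
  LinearMap.toContinuousLinearMap (Matrix.toLin (Module.Basis.finTwoProd ℝ)
    (Module.Basis.finTwoProd ℝ)
    !![-k.2 / (1 - k.1) ^ 2, -1 / (1 - k.1);
      -k.1 / (√(1 - (k.1 ^ 2 + k.2 ^ 2)) * (1 - k.1)) +
        √(1 - (k.1 ^ 2 + k.2 ^ 2)) / (1 - k.1) ^ 2,
      -k.2 / (√(1 - (k.1 ^ 2 + k.2 ^ 2)) * (1 - k.1))])

theorem hasFDerivAt_kleinInv {k : ℝ × ℝ} (hk : k.1 ^ 2 + k.2 ^ 2 < 1) :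
    HasFDerivAt kleinInv (kleinInvDeriv k) k := by
  have h1 : 1 - k.1 ≠ 0 := by linarith [fst_lt_one_of_sq_lt_one hk]
  have h2 : 1 - (k.1 ^ 2 + k.2 ^ 2) ≠ 0 := by linarith
  have hs : √(1 - (k.1 ^ 2 + k.2 ^ 2)) ≠ 0 := (Real.sqrt_pos.mpr (by linarith)).ne'
  have d1 : HasFDerivAt (fun k : ℝ × ℝ => k.1) (ContinuousLinearMap.fst ℝ ℝ ℝ) k := hasFDerivAt_fst
  have d2 : HasFDerivAt (fun k : ℝ × ℝ => k.2) (ContinuousLinearMap.snd ℝ ℝ ℝ) k := hasFDerivAt_snd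
  have dinv := (hasDerivAt_inv h1).comp_hasFDerivAt k (d1.const_sub 1)
  have dsqrt := (((d1.pow 2).add (d2.pow 2)).const_sub 1).sqrt h2
  rw [kleinInvDeriv, Matrix.toLin_finTwoProd_toContinuousLinearMap]
  have e1 := d2.neg.mul dinv
  have e2 := dsqrt.mul dinv
  have e := e1.prodMk e2
  refine (e.congr_fderiv ?_)
  ext
  all_goals
    simp
    try field_simp
    try ring

theorem det_kleinInvDeriv {k : ℝ × ℝ} (hk : k.1 ^ 2 + k.2 ^ 2 < 1) :
    (kleinInvDeriv k).det = 1 / (√(1 - (k.1 ^ 2 + k.2 ^ 2)) * (1 - k.1) ^ 2) := by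
  have h1 : 1 - k.1 ≠ 0 := by linarith [fst_lt_one_of_sq_lt_one hk]
  have hs : √(1 - (k.1 ^ 2 + k.2 ^ 2)) ≠ 0 := (Real.sqrt_pos.mpr (by linarith)).ne'
  have hs2 : √(1 - (k.1 ^ 2 + k.2 ^ 2)) ^ 2 = 1 - (k.1 ^ 2 + k.2 ^ 2) :=
    Real.sq_sqrt (by linarith)
  rw [kleinInvDeriv, ContinuousLinearMap.det, LinearMap.coe_toContinuousLinearMap,
    LinearMap.det_toLin, Matrix.det_fin_two_of]
  generalize √(1 - (k.1 ^ 2 + k.2 ^ 2)) = s at *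
  field_simp
  rw [hs2]
  ring

/-! ### Parametrising a triangle with a vertex at the origin -/

/-- The parametrisation of the Euclidean triangle with vertices `0`, `q`, `r` by the square: the
first parameter runs along the side from `q` to `r`, the second along the rays from `0`. -/
def trianglePoint (q r p : ℝ × ℝ) : ℝ × ℝ := p.2 • ((1 - p.1) • q + p.1 • r)

/-- The derivative of `trianglePoint`. -/
def trianglePointDeriv (q r p : ℝ × ℝ) : ℝ × ℝ →L[ℝ] ℝ × ℝ :=
  LinearMap.toContinuousLinearMap (Matrix.toLin (Module.Basis.finTwoProd ℝ)
    (Module.Basis.finTwoProd ℝ)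
    !![p.2 * (r.1 - q.1), (1 - p.1) * q.1 + p.1 * r.1;
      p.2 * (r.2 - q.2), (1 - p.1) * q.2 + p.1 * r.2])

theorem hasFDerivAt_trianglePoint (q r p : ℝ × ℝ) :
    HasFDerivAt (trianglePoint q r) (trianglePointDeriv q r p) p := by
  have d1 : HasFDerivAt (fun k : ℝ × ℝ => k.1) (ContinuousLinearMap.fst ℝ ℝ ℝ) p := hasFDerivAt_fst
  have d2 : HasFDerivAt (fun k : ℝ × ℝ => k.2) (ContinuousLinearMap.snd ℝ ℝ ℝ) p := hasFDerivAt_snd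
  have e := d2.smul (((d1.const_sub 1).smul (hasFDerivAt_const q p)).add
    (d1.smul (hasFDerivAt_const r p)))
  rw [trianglePointDeriv, Matrix.toLin_finTwoProd_toContinuousLinearMap]
  refine (e.congr_fderiv ?_)
  ext
  all_goals
    simp
    try ring

theorem det_trianglePointDeriv (q r p : ℝ × ℝ) :
    (trianglePointDeriv q r p).det = -(p.2 * (q.1 * r.2 - q.2 * r.1)) := by
  rw [trianglePointDeriv, ContinuousLinearMap.det, LinearMap.coe_toContinuousLinearMap,
    LinearMap.det_toLin, Matrix.det_fin_two_of]
  ring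

theorem trianglePoint_sq_lt_one {q r : ℝ × ℝ} (hq : q.1 ^ 2 + q.2 ^ 2 < 1)
    (hr : r.1 ^ 2 + r.2 ^ 2 < 1) {p : ℝ × ℝ} (hp : p ∈ Set.Icc (0 : ℝ) 1 ×ˢ Set.Icc (0 : ℝ) 1) :
    (trianglePoint q r p).1 ^ 2 + (trianglePoint q r p).2 ^ 2 < 1 := by
  have h := convex_combination_sq_lt_one (p := 0) (q := (1 - p.1) • q + p.1 • r) (by simp)
    (convex_combination_sq_lt_one hq hr hp.1) hp.2
  rwa [smul_zero, zero_add] at h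

theorem kleinInv_injOn : Set.InjOn kleinInv {k | k.1 ^ 2 + k.2 ^ 2 < 1} := by
  intro k hk l hl h
  obtain ⟨z, hz, ez⟩ := exists_klein_eq hk
  obtain ⟨w, hw, ew⟩ := exists_klein_eq hl
  rw [← hz, ← hw]
  rw [← ez, ← ew, Prod.mk.injEq] at h
  rw [UpperHalfPlane.ext_re_im h.1 h.2]

/-- By Cramer's rule the coefficients `s(1 - t)` and `s t` of `q` and `r` are determined; their sum
is `s`, and `s ≠ 0` then recovers `t`. -/
theorem trianglePoint_injOn {q r : ℝ × ℝ} (hD : q.1 * r.2 - q.2 * r.1 ≠ 0) :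
    Set.InjOn (trianglePoint q r) {p | 0 < p.2} := by
  rintro ⟨t, s⟩ hs ⟨t', s'⟩ hs' h
  have h1 := congrArg Prod.fst h
  have h2 := congrArg Prod.snd h
  simp only [trianglePoint, Prod.fst_add, Prod.smul_fst, smul_eq_mul, Prod.snd_add, Prod.smul_snd,
    Set.mem_ofPred_eq] at h1 h2 hs hs'
  have a1 : s * t = s' * t' := mul_right_cancel₀ hD (by linear_combination q.1 * h2 - q.2 * h1)
  have a2 : s * (1 - t) = s' * (1 - t') :=
    mul_right_cancel₀ hD (by linear_combination r.2 * h1 - r.1 * h2)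
  have a3 : s = s' := by linarith
  subst a3
  rw [mul_left_cancel₀ hs.ne' a1]

theorem injOn_kleinInv_trianglePoint {q r : ℝ × ℝ} (hq : q.1 ^ 2 + q.2 ^ 2 < 1)
    (hr : r.1 ^ 2 + r.2 ^ 2 < 1) (hD : q.1 * r.2 - q.2 * r.1 ≠ 0) :
    Set.InjOn (kleinInv ∘ trianglePoint q r) (Set.Icc (0 : ℝ) 1 ×ˢ Set.Ioc (0 : ℝ) 1) :=
  kleinInv_injOn.comp ((trianglePoint_injOn hD).mono fun _ hp => hp.2.1) fun _ hp =>
    trianglePoint_sq_lt_one hq hr ⟨hp.1, Set.Ioc_subset_Icc_self hp.2⟩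

/-- The coordinates of the points of a geodesic triangle with vertex `I`. -/
theorem image_geodesicTriangle_I (q r : ℍ) :
    (fun z : ℍ => (z.re, z.im)) '' geodesicTriangle UpperHalfPlane.I q r =
      insert (0, 1) ((kleinInv ∘ trianglePoint (klein q) (klein r)) ''
        (Set.Icc (0 : ℝ) 1 ×ˢ Set.Ioc (0 : ℝ) 1)) := by
  ext x
  constructor
  · rintro ⟨z, hz, rfl⟩
    obtain ⟨s, hs, t, ht, h⟩ := (mem_geodesicTriangle_I_iff _ _ _).mp hz
    -- The whole edge `s = 0` of the square collapses to the vertex `I`. Splitting it off leaves an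
    -- injective parametrisation and costs only a null set.
    rcases hs.1.eq_or_lt with h0 | h0
    · left
      rw [← h0, zero_smul, ← klein_I] at h
      rw [klein_injective h]
      simp
    · right
      refine ⟨(t, s), ⟨ht, h0, hs.2⟩, ?_⟩
      change kleinInv (s • ((1 - t) • klein q + t • klein r)) = _
      rw [← h, kleinInv_klein]
  · rintro (rfl | ⟨p, hp, rfl⟩)
    · refine ⟨UpperHalfPlane.I, (mem_geodesicTriangle_I_iff _ _ _).mpr
        ⟨0, by simp, 0, by simp, by simp [klein_I]⟩, by simp⟩
    · obtain ⟨z, hz, ez⟩ := exists_klein_eq (trianglePoint_sq_lt_one (klein_sq_lt_one q)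
        (klein_sq_lt_one r) ⟨hp.1, Set.Ioc_subset_Icc_self hp.2⟩)
      exact ⟨z, (mem_geodesicTriangle_I_iff _ _ _).mpr
        ⟨p.2, Set.Ioc_subset_Icc_self hp.2, p.1, hp.1, hz⟩, ez⟩

theorem volume_eq_setLIntegral_coordinates (S : Set ℍ) :
    (volume : Measure ℍ) S = ∫⁻ p : ℝ × ℝ in (fun z : ℍ => (z.re, z.im)) '' S,
      ENNReal.ofReal ((1 / p.2) ^ 2) := by
  have h : UpperHalfPlane.coe =
      ⇑Complex.measurableEquivRealProd.symm ∘ fun z : ℍ => (z.re, z.im) := rfl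
  rw [volume_eq_lintegral, h, Set.image_comp,
    ← Complex.volume_preserving_equiv_real_prod.symm.setLIntegral_comp_emb
      Complex.measurableEquivRealProd.symm.measurableEmbedding]
  refine lintegral_congr fun p => ?_
  change (((1 / ‖p.2‖₊) ^ 2 : NNReal) : ENNReal) = _
  rw [← ENNReal.ofReal_coe_nnreal]
  congr 1
  simp

/-- The density of the area of the triangle with vertices `I`, `q`, `r` in the parameters of
`trianglePoint`. -/
def triangleDensity (q r p : ℝ × ℝ) : ℝ :=
  |q.1 * r.2 - q.2 * r.1| * p.2 /
    √(1 - ((trianglePoint q r p).1 ^ 2 + (trianglePoint q r p).2 ^ 2)) ^ 3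

/-- With `k` the Klein point, the Jacobian `1 / (√(1 - |k|²) (1 - k₁)²)` of `kleinInv` times the
upper half-plane density `(1 - k₁)² / (1 - |k|²)` is the Klein density `(1 - |k|²)^(-3/2)`; the
parametrisation by the square contributes `s |q × r|`. -/
theorem volume_geodesicTriangle_I_eq_lintegral {q r : ℍ}
    (hD : (klein q).1 * (klein r).2 - (klein q).2 * (klein r).1 ≠ 0) :
    (volume : Measure ℍ) (geodesicTriangle UpperHalfPlane.I q r) =
      ∫⁻ p in Set.Icc (0 : ℝ) 1 ×ˢ Set.Ioc (0 : ℝ) 1,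
        ENNReal.ofReal (triangleDensity (klein q) (klein r) p) := by
  have hq := klein_sq_lt_one q
  have hr := klein_sq_lt_one r
  have hm : MeasurableSet (Set.Icc (0 : ℝ) 1 ×ˢ Set.Ioc (0 : ℝ) 1) :=
    measurableSet_Icc.prod measurableSet_Ioc
  rw [volume_eq_setLIntegral_coordinates, image_geodesicTriangle_I,
    setLIntegral_congr (insert_ae_eq_self _ _),
    lintegral_image_eq_lintegral_abs_det_fderiv_mul volume hm (fun p hp =>
      ((hasFDerivAt_kleinInv (trianglePoint_sq_lt_one hq hr
        ⟨hp.1, Set.Ioc_subset_Icc_self hp.2⟩)).comp p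
        (hasFDerivAt_trianglePoint (klein q) (klein r) p)).hasFDerivWithinAt)
      (injOn_kleinInv_trianglePoint hq hr hD)]
  refine setLIntegral_congr_fun hm fun p hp => ?_
  have hk := trianglePoint_sq_lt_one hq hr ⟨hp.1, Set.Ioc_subset_Icc_self hp.2⟩
  have h1 := fst_lt_one_of_sq_lt_one hk
  have hs : 0 < √(1 - ((trianglePoint (klein q) (klein r) p).1 ^ 2 +
    (trianglePoint (klein q) (klein r) p).2 ^ 2)) := Real.sqrt_pos.mpr (by linarith)
  have hdet : ((kleinInvDeriv (trianglePoint (klein q) (klein r) p)).comp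
      (trianglePointDeriv (klein q) (klein r) p)).det =
      (kleinInvDeriv (trianglePoint (klein q) (klein r) p)).det *
        (trianglePointDeriv (klein q) (klein r) p).det :=
    LinearMap.det_comp _ _
  rw [hdet, det_kleinInvDeriv hk, det_trianglePointDeriv, ← ENNReal.ofReal_mul (abs_nonneg _),
    abs_mul, abs_neg, abs_mul, abs_of_pos hp.2.1, triangleDensity, Function.comp_apply, kleinInv]
  have h1' : 0 < 1 - (trianglePoint (klein q) (klein r) p).1 := by linarith
  rw [abs_of_pos (by positivity)]
  congr 1
  field_simp

/-! ### The area of a geodesic triangle with vertex `I` -/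

theorem triangleDensity_nonneg (q r : ℝ × ℝ) {p : ℝ × ℝ} (hp : 0 ≤ p.2) :
    0 ≤ triangleDensity q r p := by
  unfold triangleDensity
  positivity

theorem continuousOn_triangleDensity {q r : ℝ × ℝ} (hq : q.1 ^ 2 + q.2 ^ 2 < 1)
    (hr : r.1 ^ 2 + r.2 ^ 2 < 1) :
    ContinuousOn (triangleDensity q r) (Set.Icc (0 : ℝ) 1 ×ˢ Set.Icc (0 : ℝ) 1) := by
  have hc : Continuous (trianglePoint q r) := by
    unfold trianglePoint
    fun_prop
  unfold triangleDensity
  refine ContinuousOn.div (by fun_prop) (by fun_prop) fun p hp => ?_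
  have := trianglePoint_sq_lt_one hq hr hp
  exact pow_ne_zero _ (Real.sqrt_pos.mpr (by linarith)).ne'

theorem measureReal_geodesicTriangle_I {q r : ℍ}
    (hD : (klein q).1 * (klein r).2 - (klein q).2 * (klein r).1 ≠ 0) :
    (volume : Measure ℍ).real (geodesicTriangle UpperHalfPlane.I q r) =
      ∫ t in (0 : ℝ)..1, ∫ s in (0 : ℝ)..1, triangleDensity (klein q) (klein r) (t, s) := by
  have hm : MeasurableSet (Set.Icc (0 : ℝ) 1 ×ˢ Set.Ioc (0 : ℝ) 1) :=
    measurableSet_Icc.prod measurableSet_Ioc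
  have hint : IntegrableOn (triangleDensity (klein q) (klein r))
      (Set.Icc (0 : ℝ) 1 ×ˢ Set.Ioc (0 : ℝ) 1) :=
    ((continuousOn_triangleDensity (klein_sq_lt_one q) (klein_sq_lt_one r)).integrableOn_compact
      (isCompact_Icc.prod isCompact_Icc)).mono_set
      (Set.prod_mono subset_rfl Set.Ioc_subset_Icc_self)
  have hnn : 0 ≤ᵐ[volume.restrict (Set.Icc (0 : ℝ) 1 ×ˢ Set.Ioc (0 : ℝ) 1)]
      triangleDensity (klein q) (klein r) :=
    (ae_restrict_iff' hm).mpr (ae_of_all _ fun p hp => triangleDensity_nonneg _ _ hp.2.1.le)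
  rw [Measure.real, volume_geodesicTriangle_I_eq_lintegral hD,
    ← integral_eq_lintegral_of_nonneg_ae hnn hint.aestronglyMeasurable]
  rw [Measure.volume_eq_prod] at hint ⊢
  rw [setIntegral_prod _ hint, integral_Icc_eq_integral_Ioc,
    ← intervalIntegral.integral_of_le zero_le_one]
  simp only [intervalIntegral.integral_of_le (zero_le_one (α := ℝ))]

theorem integral_mul_div_sqrt_pow_three (E : ℝ) {n : ℝ} (hn : 0 < n) (hn1 : n < 1) :
    ∫ s in (0 : ℝ)..1, E * s / √(1 - s ^ 2 * n) ^ 3 = E / n * (1 / √(1 - n) - 1) := by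
  have hpos : ∀ s ∈ Set.uIcc (0 : ℝ) 1, 0 < 1 - s ^ 2 * n := by
    intro s hs
    rw [Set.uIcc_of_le zero_le_one] at hs
    nlinarith [hs.1, hs.2, mul_le_one₀ hs.2 hs.1 hs.2]
  have hd : ∀ s ∈ Set.uIcc (0 : ℝ) 1,
      HasDerivAt (fun s : ℝ => E / n * (√(1 - s ^ 2 * n))⁻¹) (E * s / √(1 - s ^ 2 * n) ^ 3) s := by
    intro s hs
    have h := hpos s hs
    have h1 := Real.sqrt_pos.mpr h
    have := ((((((hasDerivAt_id s).pow 2).mul_const n).const_sub 1).sqrt h.ne').inv h1.ne').const_mul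
      (E / n)
    refine this.congr_deriv ?_
    simp
    field_simp
  rw [intervalIntegral.integral_eq_sub_of_hasDerivAt hd]
  · norm_num
    ring
  · refine ContinuousOn.intervalIntegrable ?_
    refine ContinuousOn.div (by fun_prop) (by fun_prop) fun s hs => ?_
    exact pow_ne_zero _ (Real.sqrt_pos.mpr (hpos s hs)).ne'

/-- The derivative of the area of a hyperbolic triangle with a vertex moving along a side. -/
theorem hasDerivAt_arctan_area {q r : ℝ × ℝ} (hq : q.1 ^ 2 + q.2 ^ 2 < 1)
    {E t : ℝ} (hE : E ^ 2 = (q.1 * r.2 - q.2 * r.1) ^ 2)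
    (hn0 : 0 < ((1 - t) * q.1 + t * r.1) ^ 2 + ((1 - t) * q.2 + t * r.2) ^ 2)
    (hn1 : ((1 - t) * q.1 + t * r.1) ^ 2 + ((1 - t) * q.2 + t * r.2) ^ 2 < 1) :
    HasDerivAt (fun t : ℝ => 2 * Real.arctan (t * E /
        ((1 + √(1 - (((1 - t) * q.1 + t * r.1) ^ 2 + ((1 - t) * q.2 + t * r.2) ^ 2))) *
          (1 + √(1 - (q.1 ^ 2 + q.2 ^ 2))) -
          (((1 - t) * q.1 + t * r.1) * q.1 + ((1 - t) * q.2 + t * r.2) * q.2))))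
      (E / (((1 - t) * q.1 + t * r.1) ^ 2 + ((1 - t) * q.2 + t * r.2) ^ 2) *
        (1 / √(1 - (((1 - t) * q.1 + t * r.1) ^ 2 + ((1 - t) * q.2 + t * r.2) ^ 2)) - 1)) t := by
  have h := hasDerivAt_id' t
  have d1 := ((h.const_sub 1).mul_const q.1).add (h.mul_const r.1)
  have d2 := ((h.const_sub 1).mul_const q.2).add (h.mul_const r.2)
  have hS := (((d1.pow 2).add (d2.pow 2)).const_sub 1).sqrt (by
    simp only [Pi.add_apply, Pi.pow_apply]
    linarith)
  have hB := ((hS.const_add 1).mul_const (1 + √(1 - (q.1 ^ 2 + q.2 ^ 2)))).sub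
    ((d1.mul_const q.1).add (d2.mul_const q.2))
  have hu : 0 < √(1 - (((1 - t) * q.1 + t * r.1) ^ 2 + ((1 - t) * q.2 + t * r.2) ^ 2)) :=
    Real.sqrt_pos.mpr (by linarith)
  have hu2 : √(1 - (((1 - t) * q.1 + t * r.1) ^ 2 + ((1 - t) * q.2 + t * r.2) ^ 2)) ^ 2 =
      1 - (((1 - t) * q.1 + t * r.1) ^ 2 + ((1 - t) * q.2 + t * r.2) ^ 2) :=
    Real.sq_sqrt (by linarith)
  have hv : 0 < √(1 - (q.1 ^ 2 + q.2 ^ 2)) := Real.sqrt_pos.mpr (by linarith)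
  have hv2 : √(1 - (q.1 ^ 2 + q.2 ^ 2)) ^ 2 = 1 - (q.1 ^ 2 + q.2 ^ 2) :=
    Real.sq_sqrt (by linarith)
  have hdot : ((1 - t) * q.1 + t * r.1) * q.1 + ((1 - t) * q.2 + t * r.2) * q.2 < 1 := by
    nlinarith [sq_nonneg (((1 - t) * q.1 + t * r.1) - q.1),
      sq_nonneg (((1 - t) * q.2 + t * r.2) - q.2)]
  have hBpos : 0 < (1 + √(1 - (((1 - t) * q.1 + t * r.1) ^ 2 + ((1 - t) * q.2 + t * r.2) ^ 2))) *
      (1 + √(1 - (q.1 ^ 2 + q.2 ^ 2))) -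
      (((1 - t) * q.1 + t * r.1) * q.1 + ((1 - t) * q.2 + t * r.2) * q.2) := by
    nlinarith [mul_pos hu hv]
  have hG := (((h.mul_const E).div hB hBpos.ne').arctan).const_mul 2
  refine hG.congr_deriv ?_
  simp only [Pi.add_apply, Pi.pow_apply, Pi.sub_apply, Pi.div_apply]
  clear hG hB hS d1 d2 h
  generalize √(1 - (((1 - t) * q.1 + t * r.1) ^ 2 + ((1 - t) * q.2 + t * r.2) ^ 2)) = u at *
  generalize √(1 - (q.1 ^ 2 + q.2 ^ 2)) = v at *
  generalize ha : (1 - t) * q.1 + t * r.1 = a at hu2 hn0 hn1 hdot hBpos ⊢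
  generalize hb : (1 - t) * q.2 + t * r.2 = b at hu2 hn0 hn1 hdot hBpos ⊢
  have htE : (t * E) ^ 2 = (q.1 * b - q.2 * a) ^ 2 := by
    rw [mul_pow, hE, ← ha, ← hb]
    ring
  -- Lagrange's identity `(a·q)² + (a×q)² = |a|²|q|²`, with `|a|² = (1 - u)(1 + u)` and `|q|² = (1 -
  -- v)(1 + v)`, lets the factor `(1 + u)(1 + v)` split off.
  have key1 : ((1 + u) * (1 + v) - (a * q.1 + b * q.2)) ^ 2 + (t * E) ^ 2 =
      2 * (1 + u) * (1 + v) * (1 + u * v - (a * q.1 + b * q.2)) := by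
    rw [htE]
    have e1 : a ^ 2 + b ^ 2 = 1 - u ^ 2 := by linarith
    have e2 : q.1 ^ 2 + q.2 ^ 2 = 1 - v ^ 2 := by linarith
    linear_combination (q.1 ^ 2 + q.2 ^ 2) * e1 + (1 - u ^ 2) * e2
  -- `B'` is the derivative of the denominator, spelled exactly as the differentiation rules produce
  -- it so that the rewrite can abbreviate it.
  have hB' : ∃ B', B' = -(((2 : ℕ) : ℝ) * a ^ (2 - 1) * (-1 * q.1 + 1 * r.1) +
      ((2 : ℕ) : ℝ) * b ^ (2 - 1) * (-1 * q.2 + 1 * r.2)) / (2 * u) * (1 + v) -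
      ((-1 * q.1 + 1 * r.1) * q.1 + (-1 * q.2 + 1 * r.2) * q.2) := ⟨_, rfl⟩
  obtain ⟨B', hB'⟩ := hB'
  rw [← hB']
  -- The numerator of the derivative of the quotient carries the same factor `(1 + v)(1 + uv - a·q)`
  -- as `key1`; cancelling it leaves `E / (u(1 + u))`, which is the claimed value since `a² + b² =
  -- (1 - u)(1 + u)`.
  have key2 : ((1 + u) * (1 + v) - (a * q.1 + b * q.2) - t * B') * u =
      (1 + v) * (1 + u * v - (a * q.1 + b * q.2)) := by
    have e1 : t * (-1 * q.1 + 1 * r.1) = a - q.1 := by rw [← ha]; ring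
    have e2 : t * (-1 * q.2 + 1 * r.2) = b - q.2 := by rw [← hb]; ring
    have e3 : t * B' = -(a * (a - q.1) + b * (b - q.2)) / u * (1 + v) -
        ((a - q.1) * q.1 + (b - q.2) * q.2) := by
      rw [← e1, ← e2, hB']
      push_cast
      field_simp
    rw [e3]
    field_simp
    linear_combination (1 + v) * hu2 - u * hv2
  generalize hBdef : (1 + u) * (1 + v) - (a * q.1 + b * q.2) = B at *
  have hW : 0 < 1 + u * v - (a * q.1 + b * q.2) := by
    have := mul_pos hu hv
    linarith
  have e4 : 2 * (1 / (1 + (t * E / B) ^ 2) * ((1 * E * B - t * E * B') / B ^ 2)) =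
      2 * E * (B - t * B') / (B ^ 2 + (t * E) ^ 2) := by
    have h1 : 0 < B ^ 2 + (t * E) ^ 2 := by positivity
    have h2 : 1 + (t * E / B) ^ 2 = (B ^ 2 + (t * E) ^ 2) / B ^ 2 := by
      field_simp
    rw [h2]
    generalize B ^ 2 + (t * E) ^ 2 = X at h1
    field_simp
  have e5 : B - t * B' = (1 + v) * (1 + u * v - (a * q.1 + b * q.2)) / u := by
    rw [← key2]
    field_simp
  have e6 : a ^ 2 + b ^ 2 = (1 - u) * (1 + u) := by linarith
  have hu1 : 1 - u ≠ 0 := by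
    intro h0
    rw [e6, h0, zero_mul] at hn0
    exact lt_irrefl _ hn0
  rw [e4, key1, e5, e6]
  generalize 1 + u * v - (a * q.1 + b * q.2) = W at *
  field_simp

/-- The area of a geodesic triangle with vertex `I`, in terms of its vertices in the Klein disc. -/
theorem measureReal_geodesicTriangle_I_eq_arctan_klein {q r : ℍ}
    (hD : (klein q).1 * (klein r).2 - (klein q).2 * (klein r).1 ≠ 0) :
    (volume : Measure ℍ).real (geodesicTriangle UpperHalfPlane.I q r) =
      2 * Real.arctan (|(klein q).1 * (klein r).2 - (klein q).2 * (klein r).1| /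
        ((1 + √(1 - ((klein r).1 ^ 2 + (klein r).2 ^ 2))) *
          (1 + √(1 - ((klein q).1 ^ 2 + (klein q).2 ^ 2))) -
          ((klein r).1 * (klein q).1 + (klein r).2 * (klein q).2))) := by
  rw [measureReal_geodesicTriangle_I hD]
  have hq := klein_sq_lt_one q
  have hr := klein_sq_lt_one r
  generalize klein q = q at *
  generalize klein r = r at *
  have hn1 : ∀ t ∈ Set.uIcc (0 : ℝ) 1,
      ((1 - t) * q.1 + t * r.1) ^ 2 + ((1 - t) * q.2 + t * r.2) ^ 2 < 1 := by
    intro t ht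
    rw [Set.uIcc_of_le zero_le_one] at ht
    exact convex_combination_sq_lt_one hq hr ht
  -- The cross product of `q - r` with any point of the line through `q` and `r` is `q × r ≠ 0`, so
  -- this line misses the origin.
  have hn0 : ∀ t : ℝ, 0 < ((1 - t) * q.1 + t * r.1) ^ 2 + ((1 - t) * q.2 + t * r.2) ^ 2 := by
    intro t
    by_contra hcon
    have e1 := sq_nonneg ((1 - t) * q.1 + t * r.1)
    have e2 := sq_nonneg ((1 - t) * q.2 + t * r.2)
    have h1 : (1 - t) * q.1 + t * r.1 = 0 := pow_eq_zero_iff two_ne_zero |>.mp (by linarith)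
    have h2 : (1 - t) * q.2 + t * r.2 = 0 := pow_eq_zero_iff two_ne_zero |>.mp (by linarith)
    exact hD (by linear_combination (q.1 - r.1) * h2 - (q.2 - r.2) * h1)
  have hinner : ∀ t ∈ Set.uIcc (0 : ℝ) 1, ∫ s in (0 : ℝ)..1, triangleDensity q r (t, s) =
      |q.1 * r.2 - q.2 * r.1| /
        (((1 - t) * q.1 + t * r.1) ^ 2 + ((1 - t) * q.2 + t * r.2) ^ 2) *
        (1 / √(1 - (((1 - t) * q.1 + t * r.1) ^ 2 + ((1 - t) * q.2 + t * r.2) ^ 2)) - 1) := by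
    intro t ht
    rw [← integral_mul_div_sqrt_pow_three _ (hn0 t) (hn1 t ht)]
    congr 1
    funext s
    simp only [triangleDensity, trianglePoint, Prod.fst_add, Prod.smul_fst, smul_eq_mul,
      Prod.snd_add, Prod.smul_snd, mul_add]
    ring_nf
  rw [intervalIntegral.integral_congr hinner,
    intervalIntegral.integral_eq_sub_of_hasDerivAt fun t ht =>
      hasDerivAt_arctan_area hq (sq_abs _) (hn0 t) (hn1 t ht)]
  · simp
  · refine ContinuousOn.intervalIntegrable ?_
    refine ContinuousOn.mul (ContinuousOn.div (by fun_prop) (by fun_prop) fun t _ => (hn0 t).ne') ?_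
    refine ContinuousOn.sub (ContinuousOn.div (by fun_prop) (by fun_prop) fun t ht => ?_)
      (by fun_prop)
    exact (Real.sqrt_pos.mpr (by linarith [hn1 t ht])).ne'

/-- The Poincaré disc is the stereographic projection of the hyperboloid. The minus sign in `hyp2`
makes the orientations agree, so `triangleOrientation` becomes the sign of a cross product. -/
theorem discCoord_I (z : ℍ) :
    discCoord UpperHalfPlane.I z = ⟨hyp1 z / (1 + hyp0 z), hyp2 z / (1 + hyp0 z)⟩ := by
  have hz := z.im_pos
  have h0 := hyp0_pos z
  have h1 : (z : ℂ) - (starRingEnd ℂ) (UpperHalfPlane.I : ℂ) ≠ 0 := by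
    intro h
    have := congrArg Complex.im h
    simp at this
    linarith
  rw [discCoord, div_eq_iff h1]
  apply Complex.ext
  · simp only [hyp0, hyp1, hyp2]
    simp
    field_simp
    ring
  · simp only [hyp0, hyp1, hyp2]
    simp
    field_simp
    ring

theorem sign_mul_of_pos {c x : ℝ} (hc : 0 < c) : Real.sign (c * x) = Real.sign x := by
  rcases lt_trichotomy x 0 with h | h | h
  · rw [Real.sign_of_neg h, Real.sign_of_neg (mul_neg_of_pos_of_neg hc h)]
  · rw [h, mul_zero]
  · rw [Real.sign_of_pos h, Real.sign_of_pos (mul_pos hc h)]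

theorem triangleOrientation_I (q r : ℍ) :
    triangleOrientation UpperHalfPlane.I q r =
      Real.sign (hyp1 q * hyp2 r - hyp2 q * hyp1 r) := by
  have hq := hyp0_pos q
  have hr := hyp0_pos r
  rw [triangleOrientation, discCoord_I, discCoord_I]
  have : ((starRingEnd ℂ) (⟨hyp1 q / (1 + hyp0 q), hyp2 q / (1 + hyp0 q)⟩ : ℂ) *
      ⟨hyp1 r / (1 + hyp0 r), hyp2 r / (1 + hyp0 r)⟩).im =
      ((1 + hyp0 q) * (1 + hyp0 r))⁻¹ * (hyp1 q * hyp2 r - hyp2 q * hyp1 r) := by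
    simp
    field_simp
    ring
  rw [this, sign_mul_of_pos (by positivity)]

/-- The signed area of a geodesic triangle with vertex `I`, in hyperboloid coordinates. -/
theorem signedArea_I (q r : ℍ) :
    signedArea UpperHalfPlane.I q r =
      2 * Real.arctan ((hyp1 q * hyp2 r - hyp2 q * hyp1 r) /
        ((1 + hyp0 q) * (1 + hyp0 r) - (hyp1 q * hyp1 r + hyp2 q * hyp2 r))) := by
  have hq := hyp0_pos q
  have hr := hyp0_pos r
  rw [signedArea, triangleOrientation_I]
  have hcross : (klein q).1 * (klein r).2 - (klein q).2 * (klein r).1 =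
      (hyp0 q * hyp0 r)⁻¹ * (hyp1 q * hyp2 r - hyp2 q * hyp1 r) := by
    simp only [klein]
    field_simp
  -- In the degenerate case the orientation factor is already `0`, so no area has to be computed.
  -- Otherwise the sign is absorbed because the arctangent is odd.
  by_cases hD : hyp1 q * hyp2 r - hyp2 q * hyp1 r = 0
  · rw [hD]
    simp
  · rw [measureReal_geodesicTriangle_I_eq_arctan_klein (by rw [hcross]; positivity), hcross,
      sqrt_one_sub_klein_sq, sqrt_one_sub_klein_sq, abs_mul, abs_of_pos (by positivity)]
    have harg : (hyp0 q * hyp0 r)⁻¹ * |hyp1 q * hyp2 r - hyp2 q * hyp1 r| /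
        ((1 + 1 / hyp0 r) * (1 + 1 / hyp0 q) -
          ((klein r).1 * (klein q).1 + (klein r).2 * (klein q).2)) =
        |hyp1 q * hyp2 r - hyp2 q * hyp1 r| /
          ((1 + hyp0 q) * (1 + hyp0 r) - (hyp1 q * hyp1 r + hyp2 q * hyp2 r)) := by
      have : (1 + 1 / hyp0 r) * (1 + 1 / hyp0 q) -
          ((klein r).1 * (klein q).1 + (klein r).2 * (klein q).2) = (hyp0 q * hyp0 r)⁻¹ *
          ((1 + hyp0 q) * (1 + hyp0 r) - (hyp1 q * hyp1 r + hyp2 q * hyp2 r)) := by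
        simp only [klein]
        field_simp
        ring
      rw [this, mul_div_mul_left _ _ (by positivity)]
    rw [harg]
    rcases lt_or_gt_of_ne hD with h | h
    · rw [Real.sign_of_neg h, abs_of_neg h, neg_div, Real.arctan_neg]
      ring
    · rw [Real.sign_of_pos h, abs_of_pos h, one_mul]

/-! ### The defect of additivity of the angle function -/

theorem smul_I_re_im (A : SL(2, ℝ)) :
    (A • UpperHalfPlane.I).re = (A 0 0 * A 1 0 + A 0 1 * A 1 1) / (A 1 0 ^ 2 + A 1 1 ^ 2) ∧
      (A • UpperHalfPlane.I).im = 1 / (A 1 0 ^ 2 + A 1 1 ^ 2) ∧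
      0 < A 1 0 ^ 2 + A 1 1 ^ 2 := by
  have hdet := A.det_coe
  rw [Matrix.det_fin_two] at hdet
  have hpos : 0 < A 1 0 ^ 2 + A 1 1 ^ 2 := by
    by_contra hcon
    have h0 : A 1 0 = 0 := by nlinarith [sq_nonneg (A 1 0), sq_nonneg (A 1 1)]
    have h1 : A 1 1 = 0 := by nlinarith [sq_nonneg (A 1 0), sq_nonneg (A 1 1)]
    rw [h0, h1] at hdet
    norm_num at hdet
  have hne : (A 1 0 : ℂ) * Complex.I + A 1 1 ≠ 0 := by
    intro h
    have h0 := congrArg Complex.im h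
    have h1 := congrArg Complex.re h
    simp at h0 h1
    rw [h0, h1] at hpos
    norm_num at hpos
  have key : ((A • UpperHalfPlane.I : ℍ) : ℂ) =
      ⟨(A 0 0 * A 1 0 + A 0 1 * A 1 1) / (A 1 0 ^ 2 + A 1 1 ^ 2),
        1 / (A 1 0 ^ 2 + A 1 1 ^ 2)⟩ := by
    rw [coe_specialLinearGroup_apply]
    simp only [Algebra.algebraMap_self, RingHom.id_apply, coe_I]
    rw [div_eq_iff hne]
    apply Complex.ext
    · simp
      field_simp
      linear_combination (-A 1 0) * hdet
    · simp
      field_simp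
      linear_combination A 1 1 * hdet
  exact ⟨congrArg Complex.re key, congrArg Complex.im key, hpos⟩

/-- The hyperboloid coordinates of `A i` can be read off from the symmetric matrix `A Aᵀ`: half the
trace, half the difference of the diagonal entries, and minus the off-diagonal entry. -/
theorem hyp0_smul_I (A : SL(2, ℝ)) : hyp0 (A • UpperHalfPlane.I) =
    (A 0 0 ^ 2 + A 0 1 ^ 2 + A 1 0 ^ 2 + A 1 1 ^ 2) / 2 := by
  obtain ⟨hre, him, hpos⟩ := smul_I_re_im A
  have hdet := A.det_coe
  rw [Matrix.det_fin_two] at hdet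
  rw [hyp0, hre, him]
  field_simp
  linear_combination (-(A 0 0 * A 1 1 - A 0 1 * A 1 0 + 1)) * hdet

theorem hyp1_smul_I (A : SL(2, ℝ)) : hyp1 (A • UpperHalfPlane.I) =
    (A 0 0 ^ 2 + A 0 1 ^ 2 - A 1 0 ^ 2 - A 1 1 ^ 2) / 2 := by
  obtain ⟨hre, him, hpos⟩ := smul_I_re_im A
  have hdet := A.det_coe
  rw [Matrix.det_fin_two] at hdet
  rw [hyp1, hre, him]
  field_simp
  linear_combination (-(A 0 0 * A 1 1 - A 0 1 * A 1 0 + 1)) * hdet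

theorem hyp2_smul_I (A : SL(2, ℝ)) : hyp2 (A • UpperHalfPlane.I) =
    -(A 0 0 * A 1 0 + A 0 1 * A 1 1) := by
  obtain ⟨hre, him, hpos⟩ := smul_I_re_im A
  rw [hyp2, hre, him]
  field_simp

/-- A complex number whose argument is the defect of additivity of the rotation angle. -/
def angleDefectNumber (B A : SL(2, ℝ)) : ℂ :=
  polarNumber (B * A) * (starRingEnd ℂ) (polarNumber B) * (starRingEnd ℂ) (polarNumber A)

theorem angleDefectNumber_eq (B A : SL(2, ℝ)) :
    angleDefectNumber B A =
      ⟨2 * ((1 + hyp0 (B • UpperHalfPlane.I)) * (1 + hyp0 ((B * A) • UpperHalfPlane.I)) -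
          (hyp1 (B • UpperHalfPlane.I) * hyp1 ((B * A) • UpperHalfPlane.I) +
            hyp2 (B • UpperHalfPlane.I) * hyp2 ((B * A) • UpperHalfPlane.I))),
        -(2 * (hyp1 (B • UpperHalfPlane.I) * hyp2 ((B * A) • UpperHalfPlane.I) -
          hyp2 (B • UpperHalfPlane.I) * hyp1 ((B * A) • UpperHalfPlane.I)))⟩ := by
  -- Taking `B` and `M = BA` as the independent matrices turns the claim into polynomial identities
  -- in their entries; only the real part needs both determinants to be `1`.
  obtain ⟨M, hM⟩ : ∃ M, M = B * A := ⟨_, rfl⟩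
  have hA : A = B⁻¹ * M := by rw [hM, inv_mul_cancel_left]
  rw [angleDefectNumber, ← hM, hA]
  have hB := B.det_coe
  have hM' := M.det_coe
  rw [Matrix.det_fin_two] at hB hM'
  simp only [hyp0_smul_I, hyp1_smul_I, hyp2_smul_I]
  apply Complex.ext
  · simp [polarNumber, Matrix.SpecialLinearGroup.coe_inv, Matrix.adjugate_fin_two,
      Matrix.mul_apply, Fin.sum_univ_two]
    linear_combination (2 * (M 0 0 * M 1 1 - M 0 1 * M 1 0) +
      (M 0 0 ^ 2 + M 0 1 ^ 2 + M 1 0 ^ 2 + M 1 1 ^ 2)) * hB +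
      (2 + (B 0 0 ^ 2 + B 0 1 ^ 2 + B 1 0 ^ 2 + B 1 1 ^ 2)) * hM'
  · simp [polarNumber, Matrix.SpecialLinearGroup.coe_inv, Matrix.adjugate_fin_two,
      Matrix.mul_apply, Fin.sum_univ_two]
    ring

theorem angleDefectNumber_re_pos (B A : SL(2, ℝ)) : 0 < (angleDefectNumber B A).re := by
  rw [angleDefectNumber_eq]
  have h := Real.cosh_pos (dist (B • UpperHalfPlane.I) ((B * A) • UpperHalfPlane.I))
  rw [cosh_dist_eq_hyp] at h
  have h1 := hyp0_pos (B • UpperHalfPlane.I)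
  have h2 := hyp0_pos ((B * A) • UpperHalfPlane.I)
  change 0 < 2 * _
  nlinarith

theorem abs_arg_angleDefectNumber_lt (B A : SL(2, ℝ)) :
    |(angleDefectNumber B A).arg| < Real.pi / 2 :=
  Complex.abs_arg_lt_pi_div_two_iff.mpr (Or.inl (angleDefectNumber_re_pos B A))

/-- An argument in `(-π/2, π/2)` is the arctangent of `Im / Re`, which is minus the quotient in
`signedArea_I`. -/
theorem arg_angleDefectNumber (B A : SL(2, ℝ)) :
    (angleDefectNumber B A).arg = -(1 / 2) *
      signedArea UpperHalfPlane.I (B • UpperHalfPlane.I) ((B * A) • UpperHalfPlane.I) := by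
  obtain ⟨h1, h2⟩ := abs_lt.mp (abs_arg_angleDefectNumber_lt B A)
  rw [← Real.arctan_tan h1 h2, Complex.tan_arg, angleDefectNumber_eq, signedArea_I]
  simp only
  rw [neg_div, mul_div_mul_left _ _ two_ne_zero, Real.arctan_neg]
  ring

/-! ### From angles of single matrices to lifts along paths -/

theorem isRotationAngle_iff_polarNumber (A : SL(2, ℝ)) (θ : ℝ) :
    IsRotationAngle A θ ↔
      ∃ r : ℝ, 0 < r ∧ polarNumber A = r * Complex.exp (θ * Complex.I) := by
  rw [isRotationAngle_iff_exists]
  refine exists_congr fun r => and_congr_right fun _ => ?_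
  rw [Complex.exp_mul_I, ← Complex.ofReal_cos, ← Complex.ofReal_sin, Complex.ext_iff]
  simp [polarNumber, -Complex.ofReal_cos, -Complex.ofReal_sin]

theorem IsRotationAngle.mul {B A : SL(2, ℝ)} {θ φ : ℝ} (hB : IsRotationAngle B θ)
    (hA : IsRotationAngle A φ) :
    IsRotationAngle (B * A) (θ + φ + (angleDefectNumber B A).arg) := by
  rw [isRotationAngle_iff_polarNumber] at hA hB ⊢
  obtain ⟨r, hr, hB⟩ := hB
  obtain ⟨s, hs, hA⟩ := hA
  have hr' : (r : ℂ) ≠ 0 := by exact_mod_cast hr.ne'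
  have hs' : (s : ℂ) ≠ 0 := by exact_mod_cast hs.ne'
  have hN : angleDefectNumber B A ≠ 0 := fun h => by
    have := angleDefectNumber_re_pos B A
    rw [h] at this
    exact lt_irrefl _ this
  refine ⟨‖angleDefectNumber B A‖ / (r * s), div_pos (norm_pos_iff.mpr hN) (by positivity), ?_⟩
  have h := Complex.norm_mul_exp_arg_mul_I (angleDefectNumber B A)
  have hconj : ∀ x : ℝ, (starRingEnd ℂ) (Complex.exp (x * Complex.I)) =
      (Complex.exp (x * Complex.I))⁻¹ := fun x => by
    rw [← Complex.exp_conj, map_mul, Complex.conj_ofReal, Complex.conj_I, mul_neg, Complex.exp_neg]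
  have hdef : angleDefectNumber B A = polarNumber (B * A) * (r * s) *
      ((Complex.exp (θ * Complex.I))⁻¹ * (Complex.exp (φ * Complex.I))⁻¹) := by
    rw [angleDefectNumber, hA, hB, map_mul, map_mul, hconj, hconj, Complex.conj_ofReal,
      Complex.conj_ofReal]
    ring
  have e1 := Complex.exp_ne_zero (θ * Complex.I)
  have e2 := Complex.exp_ne_zero (φ * Complex.I)
  push_cast
  rw [add_mul, add_mul, Complex.exp_add, Complex.exp_add, mul_comm (_ * _) (Complex.exp (_ * _)),
    ← mul_assoc, div_mul_eq_mul_div, h, hdef]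
  field_simp

theorem continuous_polarNumber : Continuous polarNumber := by
  have hentry : ∀ i j, Continuous fun A : SL(2, ℝ) => A i j := fun i j =>
    Continuous.matrix_elem continuous_subtype_val i j
  have h : polarNumber = fun A : SL(2, ℝ) =>
      ((A 0 0 + A 1 1 : ℝ) : ℂ) + ((A 0 1 - A 1 0 : ℝ) : ℂ) * Complex.I := by
    funext A
    apply Complex.ext <;> simp [polarNumber]
  rw [h]
  have h00 := hentry 0 0
  have h01 := hentry 0 1
  have h10 := hentry 1 0
  have h11 := hentry 1 1
  fun_prop

/-- The values have positive real part, so they avoid the branch cut of `Complex.arg`. -/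
theorem continuous_arg_angleDefectNumber {X : Type*} [TopologicalSpace X] {f g : X → SL(2, ℝ)}
    (hf : Continuous f) (hg : Continuous g) :
    Continuous fun x => (angleDefectNumber (f x) (g x)).arg := by
  have h : Continuous fun x => angleDefectNumber (f x) (g x) :=
    ((continuous_polarNumber.comp (hf.mul hg)).mul
      (Complex.continuous_conj.comp (continuous_polarNumber.comp hf))).mul
      (Complex.continuous_conj.comp (continuous_polarNumber.comp hg))
  exact continuous_iff_continuousAt.mpr fun x =>
    ContinuousAt.comp (f := fun x => angleDefectNumber (f x) (g x)) (x := x)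
      (Complex.continuousAt_arg (Or.inl (angleDefectNumber_re_pos _ _))) h.continuousAt

theorem arg_angleDefectNumber_one : (angleDefectNumber 1 1).arg = 0 := by
  have h : polarNumber 1 = 2 := by
    apply Complex.ext <;> norm_num [polarNumber]
  rw [angleDefectNumber, mul_one, h, Complex.arg_eq_zero_iff]
  simp

/-- The defect of additivity of the rotation angle along a pair of paths. -/
def angleDefectPath (γ δ : C(I, SL(2, ℝ))) : C(I, ℝ) where
  toFun t := (angleDefectNumber (γ t) (δ t)).arg
  continuous_toFun := continuous_arg_angleDefectNumber γ.continuous δ.continuous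

theorem IsAngleLift.mul {γ δ : C(I, SL(2, ℝ))} {θ φ : C(I, ℝ)} (h1 : γ 0 = 1) (h2 : δ 0 = 1)
    (hγ : IsAngleLift γ θ) (hδ : IsAngleLift δ φ) :
    IsAngleLift (γ * δ) (θ + φ + angleDefectPath γ δ) where
  zero := by
    rw [ContinuousMap.add_apply, ContinuousMap.add_apply, hγ.zero, hδ.zero, zero_add, zero_add]
    change (angleDefectNumber (γ 0) (δ 0)).arg = 0
    rw [h1, h2, arg_angleDefectNumber_one]
  angle t := (hγ.angle t).mul (hδ.angle t)

/-- The product of two classes is represented by the pointwise product of paths, whose unique angle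
lift is the one built in `IsAngleLift.mul`; evaluating it at time `1` gives the formula. -/
theorem milnorTheta_mul (β α : SL2Tilde) :
    milnorTheta (β * α) = milnorTheta β + milnorTheta α +
      (angleDefectNumber (SL2Tilde.proj β) (SL2Tilde.proj α)).arg := by
  induction β using Con.induction_on with | H γ => ?_
  induction α using Con.induction_on with | H δ => ?_
  have hγ := isAngleLift_angleLift γ
  have hδ := isAngleLift_angleLift δ
  rw [← Con.coe_mul, milnorTheta_mk (γ * δ) (hγ.mul γ.2 δ.2 hδ), milnorTheta_mk γ hγ,
    milnorTheta_mk δ hδ]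
  rfl

end Milnor

end

theorem mainTheorem12 (α β : Milnor.SL2Tilde) :
    Milnor.milnorTheta (β * α) = Milnor.milnorTheta β + Milnor.milnorTheta α
        - (1 / 2 : ℝ) * Milnor.signedArea UpperHalfPlane.I
            (Milnor.SL2Tilde.proj β • UpperHalfPlane.I)
            ((Milnor.SL2Tilde.proj β * Milnor.SL2Tilde.proj α) • UpperHalfPlane.I) ∧
      |Milnor.milnorTheta (β * α) - Milnor.milnorTheta β - Milnor.milnorTheta α|
        < Real.pi / 2 := by
  have h := Milnor.milnorTheta_mul β α
  constructor
  · rw [h, Milnor.arg_angleDefectNumber]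
    ring
  · rw [h, sub_sub, add_sub_cancel_left]
    exact Milnor.abs_arg_angleDefectNumber_lt _ _
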